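/- **System.** Let $f:\mathbb R^n\times\mathbb R^m\to\mathbb R^n$ be locally Lipschitz, let $\kappa:\mathbb R^n\to\mathbb R^m$ be a feedforward neural network whose layers are $y\mapsto\sigma_i(W_iy+B_i)$ with continuous activation functions $\sigma_i:\mathbb R\to\mathbb R$ applied componentwise, let $\delta_c>0$ and $\mathcal X_0\subseteq\mathbb R^n$. An execution on $[0,T]$ from $x_0$ is a function $x$ with $x(0)=x_0$ that solves $\dot x=f(x,\kappa(x(k\delta_c)))$ on $[k\delta_c,(k+1)\delta_c]\cap[0,T]$ for every $k\ge 0$. If it exists and is unique, $\varphi_{\mathcal N}(x_0,T)=x(T)$. **Taylor models.** A Taylor model (TM) over a box $D$ is a pair $(p,I)$ of a polynomial and an interval; $p(z)+I$ is the set $\{p(z)+r: r\in I\}$. $B(p)$ denotes any interval containing the range of $p$ over the domain. TM arithmetic of order $k$ is generated by: constants and variables; sums $(p_f+p_g,I_f+I_g)$; products $(p_fp_g-r_k,\ I_fB(p_g)+B(p_f)I_g+I_fI_g+B(r_k))$, with $r_k$ the part of $p_fp_g$ of degree $>k$. A matrix acts on a TM vector by $A\cdot(p,I)=(Ap,AI)$.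 A TM $S$ is contained in $T$ if $B(p_S-p_T)+I_S\subseteq I_T$ for some $B$. **Algorithm.** Fix $N\ge1$, put $\delta=\delta_c/N$, and let $D\supseteq\mathcal X_0$ be a box. All TMs below are vectors over $z\in D$, or over $(z,t)\in D\times[0,\delta]$. The local initial TM of control step $1$ is $(z,0)$; that of control step $j+1$ is the state part of the $N$-th flowpipe of control step $j$ at $t=\delta$. In each control step: 1. *Control input.* The local initial TM is propagated through the network layer by layer. From the current TM $T$ one forms $T_t=W_iT+B_i$. For each component, let $Y=[\underline Y,\bar Y]$ be an interval enclosing the range of $T_t$, let $p_\sigma$ be the Bernstein polynomial of $\sigma_i$ of order $k_B\ge1$ on $Y$ (the constant $\sigma_i(\underline Y)$ if $\underline Y=\bar Y$), and let $I_\sigma$ be either the sampled remainder $[-\epsilon,\epsilon]$, $$\epsilon=\max_{1\le s\le M'}\Big(|p_\sigma(y_s)-\sigma_i(y_s)|+L\,\tfrac{\bar Y-\underline Y}{M'}\Big),\qquad y_s=\tfrac{\bar Y-\underline Y}{M'}\big(s-\tfrac12\big)+\underline Y,$$ where $M'\ge1$ and $L$ is a Lipschitz constant of $\sigma_i$ on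 $Y$ (e.g. $L=1$ for ReLU, sigmoid and tanh), or any other interval with $\sigma_i(y)\in p_\sigma(y)+I_\sigma$ for all $y$ in the range of $T_t$. The next TM is $p_\sigma(T_t)+I_\sigma$, evaluated in TM arithmetic. Optionally, symbolic remainders are used: writing $q_i(y)=p_\sigma(W_iy+B_i)=Q_iy+q_i^R(y)$ with $Q_i$ the matrix of the coefficients of the linear terms, one computes $(\phi_i,J_i)=q_i^R(T)+I_\sigma$ in TM arithmetic, and the TM after layer $i$ is $Q_i\cdots Q_1\cdot(\text{input TM})+\sum_{l\le i}(Q_i\cdots Q_{l+1})\cdot(\phi_l,J_l)$, each matrix product being formed before it is applied. 2. *ODE.* For the extended system $\dot x=f(x,u)$, $\dot u=0$, flowpipes $i=1,\dots,N$ are computed from local initial TMs $X$: for $i=1$ the pair (local initial TM of the control step, control input TM), for $i>1$ the previous flowpipe at $t=\delta$. One takes a box $Y$ enclosing the range of $X$, a polynomial vector $\Phi(y,t)$ (e.g. a Taylor expansion of the ODE solution) and an interval vector $R$ that passes the Picard test: for some TM vector $(q,J)$ overapproximating the extended vector field on the TM $(\Phi,R)$, pointwise over $Y\times[0,\delta]$,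 the TM $\big(y+\int_0^tq(y,s)\,ds,\ [0,\delta]\cdot J\big)$ is contained in $(\Phi,R)$ over $Y\times[0,\delta]$. The flowpipe is $\Phi(X,t)+R$, evaluated in TM arithmetic. **Theorem.** Let $(p(z,t),I)$ be the state part of any $i$-th flowpipe so computed in the $j$-th control step ($1\le i\le N$, $j\ge1$). Then for every $x_0\in\mathcal X_0$ and $t\in[0,\delta]$, the execution from $x_0$ exists up to time $\tau=(j-1)\delta_c+(i-1)\delta+t$, its state $\varphi_{\mathcal N}(x_0,\tau)$ at that time is uniquely determined, and $$\varphi_{\mathcal N}(x_0,\tau)\in p(x_0,t)+I.$$ That is, the computed flowpipes are point-wise (state-wise) overapproximations of the reachable set. -/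

import Mathlib

/-- A one-dimensional Taylor model `p + I` over variables indexed by `σ`: a real polynomial and a
remainder interval. The interval domain of the variables is supplied separately. A vector of
Taylor models over the same variables is a family `τ → TaylorModel σ`. -/
structure TaylorModel (σ : Type) where
  /-- the polynomial part -/
  poly : MvPolynomial σ ℝ
  /-- the remainder interval -/
  rem : NonemptyInterval ℝ

namespace NNFlow

/-! ### Intervals and boxes -/

/-- Interval multiplication. Interval addition is Mathlib's, `[a,b] + [c,d] = [a+c,b+d]`. -/
noncomputable def imul (I J : NonemptyInterval ℝ) : NonemptyInterval ℝ :=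
  ⟨(min (min (I.fst * J.fst) (I.fst * J.snd)) (min (I.snd * J.fst) (I.snd * J.snd)),
    max (max (I.fst * J.fst) (I.fst * J.snd)) (max (I.snd * J.fst) (I.snd * J.snd))), by
    exact le_trans (le_trans (min_le_left _ _) (min_le_left _ _))
      (le_trans (le_max_left _ _) (le_max_left _ _))⟩

/-- A box, i.e. a vector of intervals. -/
abbrev Box (σ : Type) : Type := σ → NonemptyInterval ℝ

/-- The set of points of a box. -/
def Box.toSet {σ : Type} (D : Box σ) : Set (σ → ℝ) := {z | ∀ i, z i ∈ D i}

/-- The interval `[0, δ]`. -/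
def timeInterval (δ : ℝ) (hδ : 0 ≤ δ) : NonemptyInterval ℝ := ⟨(0, δ), hδ⟩

/-- Add a time variable to a set of variables: `some i` is the old variable `i`, `none` is the
time. The point `(z, t)`. -/
def withTime {σ : Type} (z : σ → ℝ) (t : ℝ) : Option σ → ℝ := fun o => o.elim t z

/-- The box `D × [0, δ]`. -/
def Box.withTime {σ : Type} (D : Box σ) (δ : ℝ) (hδ : 0 ≤ δ) : Box (Option σ) :=
  fun o => o.elim (timeInterval δ hδ) D

/-- `E` is an interval enclosure of the range of the polynomial `p` over the box `D`, i.e. an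
admissible value of `B(p)`. -/
def Encloses {σ : Type} (D : Box σ) (p : MvPolynomial σ ℝ) (E : NonemptyInterval ℝ) : Prop :=
  ∀ z ∈ D.toSet, MvPolynomial.eval z p ∈ E

/-! ### Taylor models and their arithmetic -/

end NNFlow

namespace TaylorModel

open NNFlow

/-- The set `p(z) + I`. -/
def valueAt {σ : Type} (T : TaylorModel σ) (z : σ → ℝ) : Set ℝ :=
  {y | ∃ r ∈ T.rem, y = MvPolynomial.eval z T.poly + r}

/-- The box `p(z) + I` for a vector of Taylor models. -/
def boxAt {σ τ : Type} (T : τ → TaylorModel σ) (z : σ → ℝ) : Set (τ → ℝ) :=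
  {y | ∀ l, y l ∈ (T l).valueAt z}

/-- The interval `Y` contains the range of `T` over the domain `D`. -/
def RangeIn {σ : Type} (D : Box σ) (T : TaylorModel σ) (Y : NonemptyInterval ℝ) : Prop :=
  ∀ z ∈ D.toSet, ∀ y ∈ T.valueAt z, y ∈ Y

/-- The exact Taylor model `(p, [0,0])`. -/
def ofPoly {σ : Type} (p : MvPolynomial σ ℝ) : TaylorModel σ := ⟨p, NonemptyInterval.pure 0⟩

/-- Enlarging the remainder: `T + I`. -/
def addRem {σ : Type} (T : TaylorModel σ) (I : NonemptyInterval ℝ) : TaylorModel σ :=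
  ⟨T.poly, T.rem + I⟩

/-- The sum of two Taylor models. -/
noncomputable def add {σ : Type} (S T : TaylorModel σ) : TaylorModel σ :=
  ⟨S.poly + T.poly, S.rem + T.rem⟩

/-- The part of a polynomial of degree at most `k`. -/
noncomputable def truncPoly {σ : Type} (k : ℕ) (p : MvPolynomial σ ℝ) : MvPolynomial σ ℝ :=
  ∑ d ∈ Finset.range (k + 1), MvPolynomial.homogeneousComponent d p

/-- `T` is an order-`k` product of `S₁` and `S₂` over `D`: with `r` the part of `p₁ p₂` of
degree `> k`, `T = (p₁ p₂ - r, I₁ B(p₂) + B(p₁) I₂ + I₁ I₂ + B(r))` for some choice of the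
enclosures `B(·)`. -/
def IsMul {σ : Type} (k : ℕ) (D : Box σ) (S₁ S₂ T : TaylorModel σ) : Prop :=
  ∃ E₁ E₂ Er : NonemptyInterval ℝ,
    Encloses D S₁.poly E₁ ∧ Encloses D S₂.poly E₂ ∧
    Encloses D (S₁.poly * S₂.poly - truncPoly k (S₁.poly * S₂.poly)) Er ∧
    T.poly = truncPoly k (S₁.poly * S₂.poly) ∧
    T.rem = imul S₁.rem E₂ + imul E₁ S₂.rem + imul S₁.rem S₂.rem + Er

/-- `PolyEval k D S q T`: the Taylor model `T` is a possible result of evaluating the polynomial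
`q` at the vector `S` of Taylor models in order-`k` Taylor model arithmetic over `D`. The order in
which the additions and multiplications are carried out is left open (sum of monomials, Horner
form, ...). -/
inductive PolyEval {σ τ : Type} (k : ℕ) (D : Box σ) (S : τ → TaylorModel σ) :
    MvPolynomial τ ℝ → TaylorModel σ → Prop
  | const (a : ℝ) : PolyEval k D S (MvPolynomial.C a) (ofPoly (MvPolynomial.C a))
  | var (i : τ) : PolyEval k D S (MvPolynomial.X i) (S i)
  | add {q₁ q₂ : MvPolynomial τ ℝ} {T₁ T₂ : TaylorModel σ} :
      PolyEval k D S q₁ T₁ → PolyEval k D S q₂ T₂ → PolyEval k D S (q₁ + q₂) (T₁.add T₂)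
  | mul {q₁ q₂ : MvPolynomial τ ℝ} {T₁ T₂ T : TaylorModel σ} :
      PolyEval k D S q₁ T₁ → PolyEval k D S q₂ T₂ → IsMul k D T₁ T₂ T →
      PolyEval k D S (q₁ * q₂) T

/-- The linear map `A · T` on a vector of Taylor models. -/
noncomputable def linMap {σ : Type} {a b : ℕ} (A : Matrix (Fin b) (Fin a) ℝ)
    (T : Fin a → TaylorModel σ) (l : Fin b) : TaylorModel σ :=
  ⟨∑ j, MvPolynomial.C (A l j) * (T j).poly,
    ∑ j, imul (NonemptyInterval.pure (A l j)) (T j).rem⟩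

/-- The affine map `W · T + B` on a vector of Taylor models. -/
noncomputable def affMap {σ : Type} {a b : ℕ} (W : Matrix (Fin b) (Fin a) ℝ) (B : Fin b → ℝ)
    (T : Fin a → TaylorModel σ) (l : Fin b) : TaylorModel σ :=
  (linMap W T l).add (ofPoly (MvPolynomial.C (B l)))

/-- `S` (over `D`) is contained in `T`: an interval evaluation of `p_S - p_T + I_S` is contained
in the remainder `I_T`. (`≤` on intervals is inclusion.) -/
def Contained {σ : Type} (D : Box σ) (S T : TaylorModel σ) : Prop :=
  ∃ E : NonemptyInterval ℝ, Encloses D (S.poly - T.poly) E ∧ E + S.rem ≤ T.rem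

/-- A Taylor model in `z`, regarded as a Taylor model in `(z, t)`. -/
noncomputable def liftTime {σ : Type} (T : TaylorModel σ) : TaylorModel (Option σ) :=
  ⟨MvPolynomial.rename some T.poly, T.rem⟩

/-- Substituting the value `δ` for the time in a Taylor model in `(z, t)`. -/
noncomputable def atTime {σ : Type} (δ : ℝ) (T : TaylorModel (Option σ)) : TaylorModel σ :=
  ⟨MvPolynomial.aeval (fun o : Option σ => o.elim (MvPolynomial.C δ) MvPolynomial.X) T.poly,
    T.rem⟩

/-- The antiderivative `∫₀ᵗ p(z, s) ds` of a polynomial in `(z, t)`. -/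
noncomputable def integTime {σ : Type} (p : MvPolynomial (Option σ) ℝ) :
    MvPolynomial (Option σ) ℝ :=
  ∑ e ∈ p.support, MvPolynomial.monomial (e + Finsupp.single none 1)
    (p.coeff e / ((e none : ℝ) + 1))

end TaylorModel

namespace NNFlow

open TaylorModel

/-! ### Feedforward networks -/

/-- Feedforward neural networks with `n` inputs, built by appending fully connected layers. The
layers may have different widths and different continuous activation functions; all neurons of a
layer share one. -/
inductive Network (n : ℕ) : ℕ → Type
  | input : Network n n
  | layer {a b : ℕ} (net : Network n a) (W : Matrix (Fin b) (Fin a) ℝ) (B : Fin b → ℝ)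
      (act : ℝ → ℝ) (hact : Continuous act) : Network n b

/-- The input-output mapping of a network. -/
def Network.eval {n : ℕ} : {a : ℕ} → Network n a → (Fin n → ℝ) → (Fin a → ℝ)
  | _, .input, x => x
  | _, .layer net W B act _, x => fun l => act (Matrix.mulVec W (net.eval x) l + B l)

/-! ### Neural-network controlled systems -/

/-- A neural-network controlled system with `n` state variables and `m` control inputs. -/
structure NNCS (n m : ℕ) where
  /-- right-hand side of the plant dynamics `x' = f(x, u)` -/
  f : (Fin n → ℝ) → (Fin m → ℝ) → (Fin n → ℝ)
  f_lip : LocallyLipschitz (fun q : (Fin n → ℝ) × (Fin m → ℝ) => f q.1 q.2)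
  /-- the neural network controller -/
  net : Network n m
  /-- the control stepsize -/
  δc : ℝ
  δc_pos : 0 < δc
  /-- the set of initial states -/
  X0 : Set (Fin n → ℝ)

/-- `x` is an execution on `[0, T]` from `x₀`: on every control interval `[kδ_c, (k+1)δ_c]`, as
far as it lies within `[0, T]`, `x` solves `x' = f(x, v_k)` with `v_k = κ(x(kδ_c))`. (Continuity on
`[0, T]` follows, since the derivative is taken on closed intervals.) -/
def NNCS.IsExecution {n m : ℕ} (S : NNCS n m) (x₀ : Fin n → ℝ) (T : ℝ) (x : ℝ → Fin n → ℝ) :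
    Prop :=
  x 0 = x₀ ∧
  ∀ k : ℕ, ∀ t ∈ Set.Icc ((k : ℝ) * S.δc) (min (((k : ℝ) + 1) * S.δc) T),
    HasDerivWithinAt x (S.f (x t) (S.net.eval (x ((k : ℝ) * S.δc))))
      (Set.Icc ((k : ℝ) * S.δc) (min (((k : ℝ) + 1) * S.δc) T)) t

open Classical in
/-- The flowmap: the state at time `t` of the execution from `x₀` (a junk value if there is no
execution on `[0, t]`). -/
noncomputable def NNCS.flowmap {n m : ℕ} (S : NNCS n m) (x₀ : Fin n → ℝ) (t : ℝ) : Fin n → ℝ :=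
  if h : ∃ x, S.IsExecution x₀ t x then h.choose t else 0

/-- The extended vector field `(x, u)' = (f(x, u), 0)`; `Sum.inl` indexes the state variables and
`Sum.inr` the control inputs. -/
def NNCS.extField {n m : ℕ} (S : NNCS n m) (y : Fin n ⊕ Fin m → ℝ) : Fin n ⊕ Fin m → ℝ :=
  Sum.elim (S.f (fun i => y (Sum.inl i)) (fun i => y (Sum.inr i))) (fun _ => 0)

/-- The user-given parameters of the method. -/
structure Settings where
  /-- order of the Taylor model arithmetic -/
  order : ℕ
  /-- order of the Bernstein polynomials -/
  bernOrder : ℕ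
  bernOrder_pos : 0 < bernOrder
  /-- number of samples for the remainder of a Bernstein polynomial -/
  samples : ℕ
  samples_pos : 0 < samples
  /-- number of flowpipes per control step -/
  steps : ℕ
  steps_pos : 0 < steps

/-- The flowpipe time stepsize `δ = δ_c / N`. -/
noncomputable def NNCS.stepsize {n m : ℕ} (S : NNCS n m) (c : Settings) : ℝ := S.δc / c.steps

theorem NNCS.stepsize_nonneg {n m : ℕ} (S : NNCS n m) (c : Settings) : 0 ≤ S.stepsize c :=
  div_nonneg S.δc_pos.le (Nat.cast_nonneg _)

/-! ### Bernstein overapproximation of activation functions -/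

/-- The Bernstein polynomial of order `k` of `act` on `Y = [Y.fst, Y.snd]`; on a one-point
interval, the constant `act Y.fst`. -/
noncomputable def bernsteinApprox (act : ℝ → ℝ) (k : ℕ) (Y : NonemptyInterval ℝ) :
    Polynomial ℝ :=
  if Y.fst = Y.snd then Polynomial.C (act Y.fst) else
    ∑ s ∈ Finset.range (k + 1),
      Polynomial.C (act ((Y.snd - Y.fst) / k * s + Y.fst) * (k.choose s : ℝ) /
          (Y.snd - Y.fst) ^ k) *
        (Polynomial.X - Polynomial.C Y.fst) ^ s * (Polynomial.C Y.snd - Polynomial.X) ^ (k - s)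

/-- The midpoint of the `i`-th (`i = 0, ..., N - 1`) of `N` equal parts of `Y`. -/
noncomputable def samplePoint (Y : NonemptyInterval ℝ) (N : ℕ) (i : Fin N) : ℝ :=
  (Y.snd - Y.fst) / N * ((i : ℝ) + 1 / 2) + Y.fst

/-- The sampled remainder `[-ε, ε]`, where `ε` is the maximum over the `N` sample points `s` of
`|p(s) - act(s)| + L (Y.snd - Y.fst) / N`, for a Lipschitz constant `L` of `act` on `Y`. -/
def IsSampledRemainder (act : ℝ → ℝ) (N : ℕ) (Y : NonemptyInterval ℝ) (p : Polynomial ℝ)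
    (I : NonemptyInterval ℝ) : Prop :=
  ∃ L : NNReal, LipschitzOnWith L act (Set.Icc Y.fst Y.snd) ∧
    ∃ ε : ℝ, IsGreatest (Set.range fun i : Fin N =>
        |p.eval (samplePoint Y N i) - act (samplePoint Y N i)| + L * ((Y.snd - Y.fst) / N)) ε ∧
      I.fst = -ε ∧ I.snd = ε

/-- A safe remainder: `act(y) ∈ p(y) + I` for all `y` in the range of `T`. -/
def IsSafeRemainder {σ : Type} (D : Box σ) (act : ℝ → ℝ) (T : TaylorModel σ) (p : Polynomial ℝ)
    (I : NonemptyInterval ℝ) : Prop :=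
  ∀ z ∈ D.toSet, ∀ y ∈ T.valueAt z, act y - p.eval y ∈ I

/-- `(p, I)` is a Bernstein overapproximation of `act` over the range of the Taylor model `T`:
`p` is the Bernstein polynomial on an interval `Y` enclosing that range, and `I` is the sampled
remainder or any other safe remainder. -/
def IsActApprox {σ : Type} (c : Settings) (D : Box σ) (act : ℝ → ℝ) (T : TaylorModel σ)
    (p : Polynomial ℝ) (I : NonemptyInterval ℝ) : Prop :=
  ∃ Y : NonemptyInterval ℝ, T.RangeIn D Y ∧ p = bernsteinApprox act c.bernOrder Y ∧
    (IsSampledRemainder act c.samples Y p I ∨ IsSafeRemainder D act T p I)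

/-! ### Taylor models of network outputs -/

/-- Layer-by-layer propagation. `LayerwiseOutput c D X net T`: the Taylor model vector `T` is a
possible output for the input `X`. Each layer computes `Tt = W · T + B`, Bernstein
overapproximations `(p, I)` of the activation function over `Tt`, and `p(Tt) + I`. -/
inductive LayerwiseOutput {σ : Type} {n : ℕ} (c : Settings) (D : Box σ)
    (X : Fin n → TaylorModel σ) : {a : ℕ} → Network n a → (Fin a → TaylorModel σ) → Prop
  | input : LayerwiseOutput c D X Network.input X
  | layer {a b : ℕ} {net : Network n a} {W : Matrix (Fin b) (Fin a) ℝ} {B : Fin b → ℝ}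
      {act : ℝ → ℝ} {hact : Continuous act} {T : Fin a → TaylorModel σ}
      {T' : Fin b → TaylorModel σ} {p : Fin b → Polynomial ℝ} {I : Fin b → NonemptyInterval ℝ} :
      LayerwiseOutput c D X net T →
      (∀ l, IsActApprox c D act (affMap W B T l) (p l) (I l)) →
      (∀ l, PolyEval c.order D (affMap W B T) (Polynomial.aeval (MvPolynomial.X l) (p l)) (T' l)) →
      LayerwiseOutput c D X (Network.layer net W B act hact) (fun l => (T' l).addRem (I l))

/-- A summand `A · T` that is kept symbolic: the matrix and the Taylor model vector are stored
separately. -/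
structure SymTerm (σ : Type) (a : ℕ) where
  /-- dimension of the Taylor model vector -/
  dim : ℕ
  /-- the accumulated matrix -/
  mat : Matrix (Fin a) (Fin dim) ℝ
  /-- the Taylor model vector -/
  tm : Fin dim → TaylorModel σ

/-- Multiply the matrix of a symbolic term by `Q`. -/
noncomputable def SymTerm.mulLeft {σ : Type} {a b : ℕ} (Q : Matrix (Fin b) (Fin a) ℝ)
    (s : SymTerm σ a) : SymTerm σ b :=
  ⟨s.dim, Q * s.mat, s.tm⟩

/-- Evaluation of a sum of symbolic terms. -/
noncomputable def symSum {σ : Type} {a : ℕ} (L : List (SymTerm σ a)) (l : Fin a) :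
    TaylorModel σ :=
  ⟨(L.map fun s => (linMap s.mat s.tm l).poly).sum, (L.map fun s => (linMap s.mat s.tm l).rem).sum⟩

/-- The composite polynomial `q(y) = p(W y + B)` of a layer. -/
noncomputable def layerPoly {a b : ℕ} (W : Matrix (Fin b) (Fin a) ℝ) (B : Fin b → ℝ)
    (p : Fin b → Polynomial ℝ) (l : Fin b) : MvPolynomial (Fin a) ℝ :=
  Polynomial.aeval (∑ j, MvPolynomial.C (W l j) * MvPolynomial.X j + MvPolynomial.C (B l)) (p l)

/-- The matrix of the coefficients of the linear terms of `q`. -/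
noncomputable def linCoeff {a b : ℕ} (q : Fin b → MvPolynomial (Fin a) ℝ) :
    Matrix (Fin b) (Fin a) ℝ :=
  fun l j => (q l).coeff (Finsupp.single j 1)

/-- What remains of `q` after removal of the linear terms. -/
noncomputable def nonlinPart {a b : ℕ} (q : Fin b → MvPolynomial (Fin a) ℝ) (l : Fin b) :
    MvPolynomial (Fin a) ℝ :=
  q l - ∑ j, MvPolynomial.C (linCoeff q l j) * MvPolynomial.X j

/-- Propagation with symbolic remainders. After `i` layers the list holds the terms
`Q_i ⋯ Q_1 · (p, I)` and `Q_i ⋯ Q_{j+1} · (φ_j, J_j)`, `j ≤ i`, and the current Taylor model is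
their sum. -/
inductive SymbolicOutput {σ : Type} {n : ℕ} (c : Settings) (D : Box σ)
    (X : Fin n → TaylorModel σ) : {a : ℕ} → Network n a → List (SymTerm σ a) → Prop
  | input : SymbolicOutput c D X Network.input [⟨n, 1, X⟩]
  | layer {a b : ℕ} {net : Network n a} {W : Matrix (Fin b) (Fin a) ℝ} {B : Fin b → ℝ}
      {act : ℝ → ℝ} {hact : Continuous act} {L : List (SymTerm σ a)}
      {T' : Fin b → TaylorModel σ} {p : Fin b → Polynomial ℝ} {I : Fin b → NonemptyInterval ℝ} :
      SymbolicOutput c D X net L →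
      (∀ l, IsActApprox c D act (affMap W B (symSum L) l) (p l) (I l)) →
      (∀ l, PolyEval c.order D (symSum L) (nonlinPart (layerPoly W B p) l) (T' l)) →
      SymbolicOutput c D X (Network.layer net W B act hact)
        (L.map (SymTerm.mulLeft (linCoeff (layerPoly W B p))) ++
          [⟨b, 1, fun l => (T' l).addRem (I l)⟩])

/-- `U` is a possible Taylor model for the network output on the input `X`, computed with or
without symbolic remainders. -/
def NetOutput {σ : Type} {n a : ℕ} (c : Settings) (D : Box σ) (net : Network n a)
    (X : Fin n → TaylorModel σ) (U : Fin a → TaylorModel σ) : Prop :=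
  LayerwiseOutput c D X net U ∨ ∃ L, SymbolicOutput c D X net L ∧ U = symSum L

/-! ### Taylor model integration of ODEs -/

/-- `q` is a Taylor model overapproximation, over `(y, t) ∈ Y × [0, δ]`, of the composition of the
vector field `F` with the Taylor model `T`. -/
def IsFieldEval {τ : Type} (F : (τ → ℝ) → (τ → ℝ)) (Y : Box τ) (δ : ℝ)
    (T q : τ → TaylorModel (Option τ)) : Prop :=
  ∀ y ∈ Y.toSet, ∀ t ∈ Set.Icc 0 δ, ∀ w ∈ boxAt T (withTime y t), F w ∈ boxAt q (withTime y t)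

/-- The Picard operator `y + ∫₀ᵗ q(y, s) ds` in Taylor model arithmetic. -/
noncomputable def picardImage {τ : Type} (δ : ℝ) (hδ : 0 ≤ δ)
    (q : τ → TaylorModel (Option τ)) (l : τ) : TaylorModel (Option τ) :=
  ⟨MvPolynomial.X (some l) + integTime (q l).poly, imul (timeInterval δ hδ) (q l).rem⟩

/-- The remainder `R` of the polynomial `Φ` is validated over `Y × [0, δ]`: the Picard operator
maps the Taylor model `(Φ, R)` to a Taylor model contained in `(Φ, R)`. -/
def PicardValidated {τ : Type} (F : (τ → ℝ) → (τ → ℝ)) (Y : Box τ) (δ : ℝ) (hδ : 0 ≤ δ)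
    (Φ : τ → MvPolynomial (Option τ) ℝ) (R : Box τ) : Prop :=
  ∃ q : τ → TaylorModel (Option τ),
    IsFieldEval F Y δ (fun l => ⟨Φ l, R l⟩) q ∧
    ∀ l, Contained (Y.withTime δ hδ) (picardImage δ hδ q l) ⟨Φ l, R l⟩

/-- One integration step for `y' = F(y)`: `P`, a Taylor model vector in `(z, t)`, is a possible
flowpipe over `[0, δ]` from the local initial set `X`. A polynomial `Φ` in `(y, t)` (such as a
Taylor expansion of the ODE solution) is given a remainder `R` validated for all `y` in a box `Y`
enclosing `X`, and `(Φ(X, t), R)` is evaluated in Taylor model arithmetic. -/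
def FlowpipeStep {σ τ : Type} (F : (τ → ℝ) → (τ → ℝ)) (k : ℕ) (D : Box σ) (δ : ℝ) (hδ : 0 ≤ δ)
    (X : τ → TaylorModel σ) (P : τ → TaylorModel (Option σ)) : Prop :=
  ∃ (Y : Box τ) (Φ : τ → MvPolynomial (Option τ) ℝ) (R : Box τ)
    (T : τ → TaylorModel (Option σ)),
    (∀ l, (X l).RangeIn D (Y l)) ∧
    PicardValidated F Y δ hδ Φ R ∧
    (∀ l, PolyEval k (D.withTime δ hδ)
      (fun o : Option τ => o.elim (ofPoly (MvPolynomial.X none)) (fun i => (X i).liftTime))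
      (Φ l) (T l)) ∧
    ∀ l, P l = (T l).addRem (R l)

/-! ### Flowpipe construction for the closed loop -/

/-- The initial set, as the exact Taylor model `z` over the domain `D`. -/
noncomputable def initialTM (n : ℕ) (i : Fin n) : TaylorModel (Fin n) :=
  ofPoly (MvPolynomial.X i)

/-- The state components of a vector indexed by states and control inputs. -/
def statePart {n m : ℕ} {α : Type} (P : Fin n ⊕ Fin m → α) (i : Fin n) : α := P (Sum.inl i)

/-- `IsFlowpipe S c D j i P`: the Taylor model vector `P` in `(z, t)` (for the state variables and
the control inputs) is a possible `i`-th flowpipe of the `j`-th control step, `i, j ≥ 1`, computed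
for the system `S` with initial states in the box `D`. -/
inductive IsFlowpipe {n m : ℕ} (S : NNCS n m) (c : Settings) (D : Box (Fin n)) :
    ℕ → ℕ → (Fin n ⊕ Fin m → TaylorModel (Option (Fin n))) → Prop
  /-- the first flowpipe of the first control step -/
  | init {U : Fin m → TaylorModel (Fin n)}
      {P : Fin n ⊕ Fin m → TaylorModel (Option (Fin n))} :
      NetOutput c D S.net (initialTM n) U →
      FlowpipeStep S.extField c.order D (S.stepsize c) (S.stepsize_nonneg c)
        (Sum.elim (initialTM n) U) P →
      IsFlowpipe S c D 1 1 P
  /-- the next flowpipe in the same control step -/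
  | step {j i : ℕ} {P P' : Fin n ⊕ Fin m → TaylorModel (Option (Fin n))} :
      IsFlowpipe S c D j i P → i < c.steps →
      FlowpipeStep S.extField c.order D (S.stepsize c) (S.stepsize_nonneg c)
        (fun l => (P l).atTime (S.stepsize c)) P' →
      IsFlowpipe S c D j (i + 1) P'
  /-- the first flowpipe of the next control step -/
  | control {j : ℕ} {P P' : Fin n ⊕ Fin m → TaylorModel (Option (Fin n))}
      {U : Fin m → TaylorModel (Fin n)} :
      IsFlowpipe S c D j c.steps P →
      NetOutput c D S.net (fun l => (statePart P l).atTime (S.stepsize c)) U →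
      FlowpipeStep S.extField c.order D (S.stepsize c) (S.stepsize_nonneg c)
        (Sum.elim (fun l => (statePart P l).atTime (S.stepsize c)) U) P' →
      IsFlowpipe S c D (j + 1) 1 P'

end NNFlow

open NNFlow TaylorModel

/-! Soundness is proved pointwise: fix `z = x₀` in `D` and show that each operation of the algorithm
sends real values lying in the input Taylor models at `z` to a value lying in the output Taylor
model at the same `z`. Induction along the algorithm then gives the theorem, provided that each of
its three ingredients is sound.

Activation functions: a Bernstein polynomial inherits the Lipschitz constant `L` of the function
(`lipschitzOnWith_bernsteinApprox`). Every point of `Y` is within half a cell of a sample, so the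
approximation error varies from its sampled value by at most twice `L` times half a cell, which is
the correction built into `ε` (`IsSampledRemainder.sub_eval_mem`).

Networks: layerwise propagation is sound by interval arithmetic. With symbolic remainders the
invariant is a decomposition of the output into exact summands (`SymbolicOutput.isSymValue`).

ODEs: the vector field is truncated outside the validated tube, which makes it bounded and
Lipschitz, so a solution exists on all of `[0, δ]`. The Picard test confines this solution to the
tube, where nothing was truncated (`PicardValidated.exists_solution`).

Solutions are glued into an execution (`NNCS.IsExecution.exists_extension`), so existence is a
conclusion of the induction `IsFlowpipe.exists_execution`. Uniqueness is separate
(`NNCS.IsExecution.eqOn`). -/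

namespace NonemptyInterval

/-! ### Soundness of interval arithmetic -/

theorem add_mem_add {I J : NonemptyInterval ℝ} {a b : ℝ} (ha : a ∈ I) (hb : b ∈ J) :
    a + b ∈ I + J :=
  ⟨add_le_add ha.1 hb.1, add_le_add ha.2 hb.2⟩

theorem mem_of_le {I J : NonemptyInterval ℝ} (h : I ≤ J) {a : ℝ} (ha : a ∈ I) : a ∈ J :=
  ⟨h.1.trans ha.1, ha.2.trans h.2⟩

theorem sum_mem_sum {ι : Type*} (s : Finset ι) {I : ι → NonemptyInterval ℝ} {a : ι → ℝ}
    (h : ∀ i ∈ s, a i ∈ I i) : ∑ i ∈ s, a i ∈ ∑ i ∈ s, I i := by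
  classical
  induction s using Finset.induction_on with
  | empty => exact zero_mem_zero
  | insert i s hi ih =>
    rw [Finset.sum_insert hi, Finset.sum_insert hi]
    exact add_mem_add (h i (Finset.mem_insert_self i s))
      (ih fun j hj => h j (Finset.mem_insert_of_mem hj))

/-- A bilinear function on a rectangle is extremal at a corner: the sign of `b` selects an endpoint
of `I`, then the sign of that endpoint selects one of `J`. -/
theorem mul_mem_imul {I J : NonemptyInterval ℝ} {a b : ℝ} (ha : a ∈ I) (hb : b ∈ J) :
    a * b ∈ imul I J := by
  obtain ⟨ha₁, ha₂⟩ := ha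
  obtain ⟨hb₁, hb₂⟩ := hb
  constructor
  · change min (min (I.fst * J.fst) (I.fst * J.snd)) (min (I.snd * J.fst) (I.snd * J.snd)) ≤ a * b
    simp only [min_le_iff]
    by_contra! h
    obtain ⟨⟨h₁, h₂⟩, h₃, h₄⟩ := h
    rcases le_total 0 b with hb | hb
    · have := mul_le_mul_of_nonneg_right ha₁ hb
      rcases le_total 0 I.fst with hI | hI <;> nlinarith
    · have := mul_le_mul_of_nonpos_right ha₂ hb
      rcases le_total 0 I.snd with hI | hI <;> nlinarith
  · change a * b ≤ max (max (I.fst * J.fst) (I.fst * J.snd)) (max (I.snd * J.fst) (I.snd * J.snd))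
    simp only [le_max_iff]
    by_contra! h
    obtain ⟨⟨h₁, h₂⟩, h₃, h₄⟩ := h
    rcases le_total 0 b with hb | hb
    · have := mul_le_mul_of_nonneg_right ha₂ hb
      rcases le_total 0 I.snd with hI | hI <;> nlinarith
    · have := mul_le_mul_of_nonpos_right ha₁ hb
      rcases le_total 0 I.fst with hI | hI <;> nlinarith

end NonemptyInterval

/-! ### Soundness of Taylor model arithmetic -/

namespace TaylorModel

open NonemptyInterval

variable {σ τ : Type}

theorem mem_valueAt {T : TaylorModel σ} {z : σ → ℝ} {y : ℝ} :
    y ∈ T.valueAt z ↔ y - MvPolynomial.eval z T.poly ∈ T.rem := by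
  constructor
  · rintro ⟨r, hr, rfl⟩
    simpa using hr
  · exact fun h => ⟨_, h, by ring⟩

theorem eval_mem_valueAt_ofPoly (p : MvPolynomial σ ℝ) (z : σ → ℝ) :
    MvPolynomial.eval z p ∈ (ofPoly p).valueAt z :=
  ⟨0, mem_pure_self 0, (add_zero _).symm⟩

theorem add_mem_valueAt_add {S T : TaylorModel σ} {z : σ → ℝ} {a b : ℝ}
    (ha : a ∈ S.valueAt z) (hb : b ∈ T.valueAt z) : a + b ∈ (S.add T).valueAt z := by
  obtain ⟨r, hr, rfl⟩ := ha
  obtain ⟨s, hs, rfl⟩ := hb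
  exact ⟨r + s, add_mem_add hr hs, by simp only [add, map_add]; ring⟩

theorem add_mem_valueAt_addRem {T : TaylorModel σ} {I : NonemptyInterval ℝ} {z : σ → ℝ} {a b : ℝ}
    (ha : a ∈ T.valueAt z) (hb : b ∈ I) : a + b ∈ (T.addRem I).valueAt z := by
  obtain ⟨r, hr, rfl⟩ := ha
  exact ⟨r + b, add_mem_add hr hb, by simp only [addRem]; ring⟩

/-- Expand `(p₁ + r)(p₂ + s)`: the terms `r p₂`, `p₁ s`, `r s` and the discarded part of `p₁ p₂`
match the four summands of the remainder. Which part is discarded plays no role. -/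
theorem IsMul.mul_mem_valueAt {k : ℕ} {D : Box σ} {S₁ S₂ T : TaylorModel σ}
    (h : IsMul k D S₁ S₂ T) {z : σ → ℝ} (hz : z ∈ D.toSet) {a b : ℝ}
    (ha : a ∈ S₁.valueAt z) (hb : b ∈ S₂.valueAt z) : a * b ∈ T.valueAt z := by
  obtain ⟨E₁, E₂, Er, h₁, h₂, hr, hp, hI⟩ := h
  obtain ⟨r, hr', rfl⟩ := ha
  obtain ⟨s, hs, rfl⟩ := hb
  rw [mem_valueAt, hp, hI]
  have h := hr z hz
  rw [map_sub, map_mul] at h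
  have := add_mem_add (add_mem_add (add_mem_add (mul_mem_imul hr' (h₂ z hz))
    (mul_mem_imul (h₁ z hz) hs)) (mul_mem_imul hr' hs)) h
  convert this using 1
  ring

theorem PolyEval.eval_mem_valueAt {k : ℕ} {D : Box σ} {S : τ → TaylorModel σ}
    {q : MvPolynomial τ ℝ} {T : TaylorModel σ} (h : PolyEval k D S q T) {z : σ → ℝ}
    (hz : z ∈ D.toSet) {y : τ → ℝ} (hy : y ∈ boxAt S z) :
    MvPolynomial.eval y q ∈ T.valueAt z := by
  induction h with
  | const a => simpa using eval_mem_valueAt_ofPoly (MvPolynomial.C a) z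
  | var i => simpa using hy i
  | add _ _ ih₁ ih₂ => simpa using add_mem_valueAt_add ih₁ ih₂
  | mul _ _ hm ih₁ ih₂ => simpa using hm.mul_mem_valueAt hz ih₁ ih₂

theorem mulVec_mem_boxAt_linMap {a b : ℕ} (A : Matrix (Fin b) (Fin a) ℝ)
    {T : Fin a → TaylorModel σ} {z : σ → ℝ} {y : Fin a → ℝ} (hy : y ∈ boxAt T z) :
    A.mulVec y ∈ boxAt (linMap A T) z := by
  intro l
  rw [mem_valueAt]
  have : ∑ j, A l j * (y j - MvPolynomial.eval z (T j).poly) ∈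
      ∑ j, imul (NonemptyInterval.pure (A l j)) (T j).rem :=
    sum_mem_sum _ fun j _ => mul_mem_imul (mem_pure_self _) (mem_valueAt.1 (hy j))
  have h : A.mulVec y l - MvPolynomial.eval z (linMap A T l).poly =
      ∑ j, A l j * (y j - MvPolynomial.eval z (T j).poly) := by
    simp [linMap, Matrix.mulVec, dotProduct, mul_sub]
  rwa [h]

theorem affine_mem_boxAt_affMap {a b : ℕ} (W : Matrix (Fin b) (Fin a) ℝ) (B : Fin b → ℝ)
    {T : Fin a → TaylorModel σ} {z : σ → ℝ} {y : Fin a → ℝ} (hy : y ∈ boxAt T z) :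
    W.mulVec y + B ∈ boxAt (affMap W B T) z := fun l =>
  add_mem_valueAt_add (mulVec_mem_boxAt_linMap W hy l)
    (by simpa using eval_mem_valueAt_ofPoly (MvPolynomial.C (B l)) z)

theorem mem_valueAt_liftTime {T : TaylorModel σ} {z : σ → ℝ} {t y : ℝ}
    (hy : y ∈ T.valueAt z) : y ∈ T.liftTime.valueAt (withTime z t) := by
  rw [mem_valueAt] at hy ⊢
  rwa [liftTime, MvPolynomial.eval_rename]

theorem mem_valueAt_atTime {T : TaylorModel (Option σ)} {z : σ → ℝ} {δ y : ℝ}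
    (hy : y ∈ T.valueAt (withTime z δ)) : y ∈ (T.atTime δ).valueAt z := by
  rw [mem_valueAt] at hy ⊢
  have h : MvPolynomial.eval z (T.atTime δ).poly =
      MvPolynomial.eval (withTime z δ) T.poly := by
    have : (MvPolynomial.eval z).comp (MvPolynomial.aeval (R := ℝ) fun o : Option σ =>
        o.elim (MvPolynomial.C δ) MvPolynomial.X).toRingHom =
        MvPolynomial.eval (withTime z δ) := by
      apply MvPolynomial.ringHom_ext
      · intro r
        simp
      · rintro (_ | i) <;> simp [withTime]
    exact congrArg (fun f => f T.poly) this
  rw [h]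
  exact hy

end TaylorModel

namespace NNFlow

open NonemptyInterval

/-! ### Bernstein polynomials -/

/-- Evaluation by de Casteljau's algorithm of the polynomial with Bernstein coefficients `a`. -/
def deCasteljau : ℕ → (ℕ → ℝ) → ℝ → ℝ
  | 0, a, _ => a 0
  | k + 1, a, x => (1 - x) * deCasteljau k a x + x * deCasteljau k (fun s => a (s + 1)) x

/-- Pascal's rule splits the sum of degree `k + 1` into the two sums of the recursion. -/
theorem deCasteljau_eq_sum_antidiagonal (k : ℕ) (a : ℕ → ℝ) (x : ℝ) :
    deCasteljau k a x = ∑ ij ∈ Finset.HasAntidiagonal.antidiagonal k,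
      (k.choose ij.1 : ℝ) * (a ij.1 * x ^ ij.1 * (1 - x) ^ ij.2) := by
  induction k generalizing a with
  | zero => simp [deCasteljau]
  | succ k ih =>
    rw [deCasteljau, ih, ih, Finset.sum_antidiagonal_choose_succ_mul
      (fun i j => a i * x ^ i * (1 - x) ^ j), Finset.mul_sum, Finset.mul_sum]
    congr 1
    · exact Finset.sum_congr rfl fun ij _ => by ring
    · refine Finset.sum_congr rfl fun ij hij => ?_
      rw [Nat.choose_symm_of_eq_add (Finset.HasAntidiagonal.mem_antidiagonal.1 hij).symm]
      ring

theorem deCasteljau_sub (k : ℕ) (a b : ℕ → ℝ) (x : ℝ) :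
    deCasteljau k a x - deCasteljau k b x = deCasteljau k (fun s => a s - b s) x := by
  induction k generalizing a b with
  | zero => rfl
  | succ k ih =>
    rw [deCasteljau, deCasteljau, deCasteljau, ← ih, ← ih]
    ring

theorem abs_deCasteljau_le {k : ℕ} {a : ℕ → ℝ} {d x : ℝ} (hx : x ∈ Set.Icc (0 : ℝ) 1)
    (ha : ∀ s ≤ k, |a s| ≤ d) : |deCasteljau k a x| ≤ d := by
  induction k generalizing a with
  | zero => exact ha 0 le_rfl
  | succ k ih =>
    have h₁ := abs_le.1 (ih fun s hs => ha s (by omega))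
    have h₂ := abs_le.1 (ih (a := fun s => a (s + 1)) fun s hs => ha (s + 1) (by omega))
    have hx₀ := hx.1
    have hx₁ : 0 ≤ 1 - x := sub_nonneg.2 hx.2
    rw [deCasteljau, abs_le]
    constructor <;> nlinarith [mul_le_mul_of_nonneg_left h₁.1 hx₁,
      mul_le_mul_of_nonneg_left h₁.2 hx₁, mul_le_mul_of_nonneg_left h₂.1 hx₀,
      mul_le_mul_of_nonneg_left h₂.2 hx₀]

/-- A discrete substitute for the fact that the derivative of a Bernstein form of degree `k` is `k`
times the form of the coefficient differences. Raising the degree adds one term `(x - y)(v' - v)`,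
and `v' - v` is a convex combination of differences of consecutive coefficients. -/
theorem abs_deCasteljau_sub_le {k : ℕ} {a : ℕ → ℝ} {d x y : ℝ} (hx : x ∈ Set.Icc (0 : ℝ) 1)
    (hy : y ∈ Set.Icc (0 : ℝ) 1) (ha : ∀ s < k, |a (s + 1) - a s| ≤ d) :
    |deCasteljau k a x - deCasteljau k a y| ≤ k * d * |x - y| := by
  induction k generalizing a with
  | zero => simp [deCasteljau]
  | succ k ih =>
    have h₁ := ih fun s hs => ha s (by omega)
    have h₂ := ih (a := fun s => a (s + 1)) fun s hs => ha (s + 1) (by omega)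
    have h₃ : |deCasteljau k (fun s => a (s + 1)) y - deCasteljau k a y| ≤ d := by
      rw [deCasteljau_sub]
      exact abs_deCasteljau_le hy fun s hs => ha s (by omega)
    have hx₀ := hx.1
    have hx₁ : 0 ≤ 1 - x := sub_nonneg.2 hx.2
    rw [deCasteljau, deCasteljau]
    set u := deCasteljau k a x
    set v := deCasteljau k a y
    set u' := deCasteljau k (fun s => a (s + 1)) x
    set v' := deCasteljau k (fun s => a (s + 1)) y
    calc |(1 - x) * u + x * u' - ((1 - y) * v + y * v')|
        = |(1 - x) * (u - v) + x * (u' - v') + (x - y) * (v' - v)| := by ring_nf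
      _ ≤ |(1 - x) * (u - v)| + |x * (u' - v')| + |(x - y) * (v' - v)| := abs_add_three _ _ _
      _ = (1 - x) * |u - v| + x * |u' - v'| + |x - y| * |v' - v| := by
          rw [abs_mul, abs_mul, abs_mul, abs_of_nonneg hx₀, abs_of_nonneg hx₁]
      _ ≤ (1 - x) * (k * d * |x - y|) + x * (k * d * |x - y|) + |x - y| * d := by gcongr
      _ = (k + 1 : ℕ) * d * |x - y| := by push_cast; ring

theorem eval_bernsteinApprox (act : ℝ → ℝ) (k : ℕ) {Y : NonemptyInterval ℝ} (hY : Y.fst < Y.snd)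
    (y : ℝ) : (bernsteinApprox act k Y).eval y =
      deCasteljau k (fun s => act ((Y.snd - Y.fst) / k * s + Y.fst))
        ((y - Y.fst) / (Y.snd - Y.fst)) := by
  have hw : Y.snd - Y.fst ≠ 0 := (sub_pos.2 hY).ne'
  rw [bernsteinApprox, if_neg hY.ne, deCasteljau_eq_sum_antidiagonal,
    Finset.Nat.sum_antidiagonal_eq_sum_range_succ_mk, Polynomial.eval_finsetSum]
  refine Finset.sum_congr rfl fun s hs => ?_
  have h₁ : 1 - (y - Y.fst) / (Y.snd - Y.fst) = (Y.snd - y) / (Y.snd - Y.fst) := by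
    field_simp
    ring
  have h₂ : (Y.snd - Y.fst) ^ k = (Y.snd - Y.fst) ^ s * (Y.snd - Y.fst) ^ (k - s) := by
    rw [← pow_add, Nat.add_sub_cancel' (Finset.mem_range_succ_iff.1 hs)]
  simp only [Polynomial.eval_mul, Polynomial.eval_C, Polynomial.eval_pow, Polynomial.eval_sub,
    Polynomial.eval_X]
  rw [h₁, div_pow, div_pow, h₂]
  field_simp

/-- No constant is lost: adjacent nodes are `(Y.snd - Y.fst) / k` apart, the degree contributes a
factor `k`, and rescaling to `[0, 1]` divides by the width of `Y`. -/
theorem lipschitzOnWith_bernsteinApprox {act : ℝ → ℝ} {L : NNReal} {k : ℕ} (hk : 0 < k)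
    {Y : NonemptyInterval ℝ} (h : LipschitzOnWith L act (Set.Icc Y.fst Y.snd)) :
    LipschitzOnWith L (fun y => (bernsteinApprox act k Y).eval y) (Set.Icc Y.fst Y.snd) := by
  refine LipschitzOnWith.of_dist_le_mul fun x hx y hy => ?_
  rcases Y.fst_le_snd.eq_or_lt with hY | hY
  · simp only [bernsteinApprox, if_pos hY, Polynomial.eval_C, dist_self]
    exact mul_nonneg L.2 dist_nonneg
  have hw : 0 < Y.snd - Y.fst := sub_pos.2 hY
  have hk' : (0 : ℝ) < k := Nat.cast_pos.2 hk
  have unit : ∀ v ∈ Set.Icc Y.fst Y.snd,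
      (v - Y.fst) / (Y.snd - Y.fst) ∈ Set.Icc (0 : ℝ) 1 := fun v hv =>
    ⟨div_nonneg (sub_nonneg.2 hv.1) hw.le, (div_le_one hw).2 (by linarith [hv.2])⟩
  have node : ∀ s : ℕ, s ≤ k →
      (Y.snd - Y.fst) / k * s + Y.fst ∈ Set.Icc Y.fst Y.snd := by
    intro s hs
    have hs' : (s : ℝ) ≤ k := Nat.cast_le.2 hs
    have h₁ : (Y.snd - Y.fst) / k * s ≤ (Y.snd - Y.fst) / k * k := by gcongr
    rw [div_mul_cancel₀ _ hk'.ne'] at h₁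
    exact ⟨by have : 0 ≤ (Y.snd - Y.fst) / k * s := by positivity
              linarith, by linarith⟩
  rw [Real.dist_eq, Real.dist_eq, eval_bernsteinApprox _ _ hY, eval_bernsteinApprox _ _ hY]
  refine (abs_deCasteljau_sub_le (d := L * ((Y.snd - Y.fst) / k)) (unit x hx) (unit y hy)
    fun s hs => ?_).trans (le_of_eq ?_)
  · have := h.dist_le_mul _ (node (s + 1) hs) _ (node s hs.le)
    rw [Real.dist_eq, Real.dist_eq] at this
    refine this.trans (le_of_eq ?_)
    congr 1
    rw [show (Y.snd - Y.fst) / k * ((s + 1 : ℕ) : ℝ) + Y.fst - ((Y.snd - Y.fst) / k * s + Y.fst) =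
      (Y.snd - Y.fst) / k by push_cast; ring, abs_of_pos (by positivity)]
  · rw [← sub_div, abs_div, abs_of_pos hw, show x - Y.fst - (y - Y.fst) = x - y by ring]
    field_simp

theorem exists_abs_sub_samplePoint_le {N : ℕ} (hN : 0 < N) {Y : NonemptyInterval ℝ} {y : ℝ}
    (hy : y ∈ Y) : ∃ i : Fin N, samplePoint Y N i ∈ Set.Icc Y.fst Y.snd ∧
      |y - samplePoint Y N i| ≤ (Y.snd - Y.fst) / N / 2 := by
  obtain ⟨hy₁, hy₂⟩ := hy
  have hN' : (0 : ℝ) < N := Nat.cast_pos.2 hN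
  set h := (Y.snd - Y.fst) / N with hh
  have hw : Y.snd - Y.fst = h * N := by rw [hh, div_mul_cancel₀ _ hN'.ne']
  have h₀ : 0 ≤ h := div_nonneg (sub_nonneg.2 Y.fst_le_snd) hN'.le
  -- Some cell contains `y`. Otherwise `y` lies beyond each cell in turn, hence beyond the last one,
  -- `M = N - 1`, and so outside `Y`.
  have key : ∃ i : ℕ, i < N ∧ h * i ≤ y - Y.fst ∧ y - Y.fst ≤ h * (i + 1) := by
    by_contra! hc
    have : ∀ i : ℕ, i ≤ N → h * i ≤ y - Y.fst := by
      intro i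
      induction i with
      | zero => intro _; simpa using hy₁
      | succ i ih => intro hi; push_cast; exact (hc i hi (ih (by omega))).le
    obtain ⟨M, rfl⟩ : ∃ M, N = M + 1 := ⟨N - 1, by omega⟩
    have := hc M (by omega) (this M (by omega))
    push_cast at hw
    linarith
  obtain ⟨i, hi, hi₁, hi₂⟩ := key
  have hi' : (i : ℝ) + 1 ≤ N := by exact_mod_cast hi
  have h₁ : 0 ≤ h * i := by positivity
  have h₂ : h * (i + 1) ≤ h * N := by gcongr
  refine ⟨⟨i, hi⟩, ?_, ?_⟩
  · simp only [samplePoint, ← hh]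
    constructor <;> nlinarith
  · simp only [samplePoint, ← hh]
    rw [abs_le]
    constructor <;> linarith

/-- Moving from `y` to the nearest midpoint changes `act` and its Bernstein polynomial by at most `L
(Y.snd - Y.fst) / (2N)` each; together this is the extra term in `ε`. -/
theorem IsSampledRemainder.sub_eval_mem {act : ℝ → ℝ} {k N : ℕ} (hk : 0 < k) (hN : 0 < N)
    {Y I : NonemptyInterval ℝ} (h : IsSampledRemainder act N Y (bernsteinApprox act k Y) I)
    {y : ℝ} (hy : y ∈ Y) : act y - (bernsteinApprox act k Y).eval y ∈ I := by
  obtain ⟨L, hL, ε, hε, h₁, h₂⟩ := h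
  obtain ⟨i, hi, hyi⟩ := exists_abs_sub_samplePoint_le hN hy
  have ha := hL.dist_le_mul y hy _ hi
  have hb := (lipschitzOnWith_bernsteinApprox hk hL).dist_le_mul y hy _ hi
  have hs := hε.2 ⟨i, rfl⟩
  simp only [Real.dist_eq] at ha hb hs
  have hLy : L * |y - samplePoint Y N i| ≤ L * ((Y.snd - Y.fst) / N / 2) := by gcongr
  set p := bernsteinApprox act k Y
  set s := samplePoint Y N i
  have : |act y - p.eval y| ≤ ε := by
    calc |act y - p.eval y|
        = |(act y - act s) + -(p.eval s - act s) + -(p.eval y - p.eval s)| := by ring_nf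
      _ ≤ |act y - act s| + |-(p.eval s - act s)| + |-(p.eval y - p.eval s)| :=
          abs_add_three _ _ _
      _ ≤ ε := by rw [abs_neg, abs_neg]; linarith
  rw [abs_le] at this
  exact ⟨h₁ ▸ this.1, h₂ ▸ this.2⟩

/-- The network proofs below use only this property, never the form of the approximating polynomial.
-/
theorem IsActApprox.isSafeRemainder {σ : Type} {c : Settings} {D : Box σ} {act : ℝ → ℝ}
    {T : TaylorModel σ} {p : Polynomial ℝ} {I : NonemptyInterval ℝ}
    (h : IsActApprox c D act T p I) : IsSafeRemainder D act T p I := by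
  obtain ⟨Y, hY, rfl, hI | hI⟩ := h
  · exact fun z hz y hy => hI.sub_eval_mem c.bernOrder_pos c.samples_pos (hY z hz y hy)
  · exact hI

/-! ### Network outputs -/

theorem eval_aeval {τ : Type} (y : τ → ℝ) (q : MvPolynomial τ ℝ) (p : Polynomial ℝ) :
    MvPolynomial.eval y (Polynomial.aeval q p) = p.eval (MvPolynomial.eval y q) := by
  rw [← MvPolynomial.coe_aeval_eq_eval, RingHom.coe_coe, ← Polynomial.aeval_algHom_apply,
    Polynomial.coe_aeval_eq_eval]

theorem LayerwiseOutput.eval_mem_boxAt {σ : Type} {n a : ℕ} {c : Settings} {D : Box σ}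
    {X : Fin n → TaylorModel σ} {net : Network n a} {T : Fin a → TaylorModel σ}
    (h : LayerwiseOutput c D X net T) {z : σ → ℝ} (hz : z ∈ D.toSet) {x : Fin n → ℝ}
    (hx : x ∈ boxAt X z) : net.eval x ∈ boxAt T z := by
  induction h with
  | input => exact hx
  | @layer a b net W B act hc T T' p I _ hact hT' ih =>
    intro l
    have hy := affine_mem_boxAt_affMap W B ih
    have h₁ := (hT' l).eval_mem_valueAt hz hy
    rw [eval_aeval, MvPolynomial.eval_X] at h₁
    -- The layer value is `p(y) + (act y - p(y))`, and the second summand lies in `I l`.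
    have h₂ := add_mem_valueAt_addRem h₁ ((hact l).isSafeRemainder z hz _ (hy l))
    rwa [add_sub_cancel] at h₂

/-- `y` is a sum of values of the symbolic terms `L` at `z`. -/
def IsSymValue {σ : Type} {a : ℕ} (z : σ → ℝ) : List (SymTerm σ a) → (Fin a → ℝ) → Prop
  | [], y => y = 0
  | s :: L, y => ∃ v ∈ boxAt s.tm z, IsSymValue z L (y - s.mat.mulVec v)

theorem IsSymValue.mem_boxAt {σ : Type} {a : ℕ} {z : σ → ℝ} {L : List (SymTerm σ a)}
    {y : Fin a → ℝ} (h : IsSymValue z L y) : y ∈ boxAt (symSum L) z := by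
  induction L generalizing y with
  | nil =>
    intro l
    rw [show y = 0 from h, mem_valueAt]
    simpa [symSum] using zero_mem_zero
  | cons s L ih =>
    obtain ⟨v, hv, h⟩ := h
    intro l
    have := add_mem_valueAt_add (mulVec_mem_boxAt_linMap s.mat hv l) (ih h l)
    simpa [symSum, add] using this

theorem IsSymValue.map_mulLeft {σ : Type} {a b : ℕ} {z : σ → ℝ} {L : List (SymTerm σ a)}
    {y : Fin a → ℝ} (h : IsSymValue z L y) (Q : Matrix (Fin b) (Fin a) ℝ) :
    IsSymValue z (L.map (SymTerm.mulLeft Q)) (Q.mulVec y) := by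
  induction L generalizing y with
  | nil =>
    rw [show y = 0 from h]
    exact Matrix.mulVec_zero Q
  | cons s L ih =>
    obtain ⟨v, hv, h⟩ := h
    refine ⟨v, hv, ?_⟩
    have := ih h
    rwa [Matrix.mulVec_sub, Matrix.mulVec_mulVec] at this

theorem IsSymValue.append_single {σ : Type} {a : ℕ} {z : σ → ℝ} {L : List (SymTerm σ a)}
    {T : Fin a → TaylorModel σ} {y v : Fin a → ℝ} (h : IsSymValue z L y) (hv : v ∈ boxAt T z) :
    IsSymValue z (L ++ [⟨a, 1, T⟩]) (y + v) := by
  induction L generalizing y with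
  | nil =>
    rw [show y = 0 from h]
    exact ⟨v, hv, by simp [IsSymValue]⟩
  | cons s L ih =>
    obtain ⟨w, hw, h⟩ := h
    refine ⟨w, hw, ?_⟩
    have := ih h
    rwa [sub_add_eq_add_sub] at this

/-- Mere membership in `symSum L` would not be inductive: interval evaluation of `(Q * A) · T` can
be tighter than that of `Q · (A · T)`. Exact summands do survive multiplication by `Q`. The new
layer value is `Q y` plus the nonlinear part at `y` plus the activation error; the last two form the
appended term. -/
theorem SymbolicOutput.isSymValue {σ : Type} {n a : ℕ} {c : Settings} {D : Box σ}
    {X : Fin n → TaylorModel σ} {net : Network n a} {L : List (SymTerm σ a)}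
    (h : SymbolicOutput c D X net L) {z : σ → ℝ} (hz : z ∈ D.toSet) {x : Fin n → ℝ}
    (hx : x ∈ boxAt X z) : IsSymValue z L (net.eval x) := by
  induction h with
  | input => exact ⟨x, hx, by simp [IsSymValue, Network.eval]⟩
  | @layer a b net W B act hc L T' p I _ hact hT' ih =>
    have hs := ih.mem_boxAt
    have hy := affine_mem_boxAt_affMap W B hs
    set y := net.eval x with hyx
    have hv : (fun l => MvPolynomial.eval y (nonlinPart (layerPoly W B p) l) +
        (act ((W.mulVec y + B) l) - (p l).eval ((W.mulVec y + B) l))) ∈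
        boxAt (fun l => (T' l).addRem (I l)) z := fun l =>
      add_mem_valueAt_addRem ((hT' l).eval_mem_valueAt hz hs)
        ((hact l).isSafeRemainder z hz _ (hy l))
    convert (ih.map_mulLeft (linCoeff (layerPoly W B p))).append_single hv using 1
    funext l
    have h₁ : MvPolynomial.eval y (layerPoly W B p l) = (p l).eval ((W.mulVec y + B) l) := by
      rw [layerPoly, eval_aeval]
      simp [Matrix.mulVec, dotProduct]
    simp only [nonlinPart, map_sub, map_sum, map_mul, MvPolynomial.eval_C, MvPolynomial.eval_X,
      h₁, Pi.add_apply, Network.eval, Matrix.mulVec, dotProduct, ← hyx]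
    ring

theorem NetOutput.eval_mem_boxAt {σ : Type} {n a : ℕ} {c : Settings} {D : Box σ}
    {net : Network n a} {X : Fin n → TaylorModel σ} {U : Fin a → TaylorModel σ}
    (h : NetOutput c D net X U) {z : σ → ℝ} (hz : z ∈ D.toSet) {x : Fin n → ℝ}
    (hx : x ∈ boxAt X z) : net.eval x ∈ boxAt U z := by
  obtain h | ⟨L, h, rfl⟩ := h
  · exact h.eval_mem_boxAt hz hx
  · exact (h.isSymValue hz hx).mem_boxAt

/-! ### Validated integration of ODEs -/

theorem eval_withTime_monomial {τ : Type} [Fintype τ] (e : Option τ →₀ ℕ) (a : ℝ) (y : τ → ℝ)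
    (t : ℝ) : MvPolynomial.eval (withTime y t) (MvPolynomial.monomial e a) =
      a * (t ^ e none * ∏ i, y i ^ e (some i)) := by
  rw [MvPolynomial.eval_monomial, Finsupp.prod_fintype _ _ (fun _ => pow_zero _),
    Fintype.prod_option]
  rfl

theorem eval_withTime_zero_integTime {τ : Type} [Fintype τ] (p : MvPolynomial (Option τ) ℝ)
    (y : τ → ℝ) : MvPolynomial.eval (withTime y 0) (integTime p) = 0 := by
  rw [integTime, map_sum]
  exact Finset.sum_eq_zero fun e _ => by rw [eval_withTime_monomial]; simp

theorem hasDerivAt_eval_integTime {τ : Type} [Fintype τ] (p : MvPolynomial (Option τ) ℝ)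
    (y : τ → ℝ) (t : ℝ) :
    HasDerivAt (fun s => MvPolynomial.eval (withTime y s) (integTime p))
      (MvPolynomial.eval (withTime y t) p) t := by
  conv =>
    enter [2]
    rw [p.as_sum, map_sum]
  simp only [integTime, map_sum]
  refine HasDerivAt.fun_sum fun e _ => ?_
  simp only [eval_withTime_monomial]
  have h : ((e none : ℝ) + 1) ≠ 0 := by positivity
  have := (((hasDerivAt_pow (e none + 1) t).mul_const (∏ i, y i ^ e (some i))).const_mul
    (p.coeff e / ((e none : ℝ) + 1)))
  refine (this.congr_deriv ?_).congr_of_eventuallyEq (.of_forall fun s => ?_)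
  · push_cast
    field_simp
  · simp

theorem continuous_eval_withTime {τ : Type} (p : MvPolynomial (Option τ) ℝ) (y : τ → ℝ) :
    Continuous fun t => MvPolynomial.eval (withTime y t) p := by
  refine (MvPolynomial.continuous_eval p).comp (continuous_pi fun o => ?_)
  cases o
  · exact continuous_id
  · exact continuous_const

theorem hasDerivWithinAt_Ici_of_Icc {E : Type*} [NormedAddCommGroup E] [NormedSpace ℝ E]
    {a b : ℝ} {g g' : ℝ → E}
    (hg : ∀ t ∈ Set.Icc a b, HasDerivWithinAt g (g' t) (Set.Icc a b) t) :
    ∀ t ∈ Set.Ico a b, HasDerivWithinAt g (g' t) (Set.Ici t) t := fun t ht =>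
  (hg t (Set.Ico_subset_Icc_self ht)).mono_of_mem_nhdsWithin
    (Filter.mem_of_superset (Icc_mem_nhdsGE ht.2) (Set.Icc_subset_Icc_left ht.1))

theorem lipschitzWith_one_pi {ι κ : Type*} [Fintype ι] [Fintype κ] {g : (ι → ℝ) → κ → ℝ}
    (h : ∀ i, LipschitzWith 1 fun v => g v i) : LipschitzWith 1 g := fun v w => by
  rw [edist_pi_def]
  exact Finset.sup_le fun i _ => h i v w

/-- A function on `[0, δ]` whose derivative stays in an interval `J` changes by an element of
`[0, δ] · J`. -/
theorem sub_mem_imul_of_hasDerivWithinAt {δ : ℝ} (hδ : 0 ≤ δ) {g g' : ℝ → ℝ}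
    {J : NonemptyInterval ℝ}
    (hg : ∀ t ∈ Set.Icc 0 δ, HasDerivWithinAt g (g' t) (Set.Icc 0 δ) t)
    (hJ : ∀ t ∈ Set.Icc 0 δ, g' t ∈ J) {t : ℝ} (ht : t ∈ Set.Icc 0 δ) :
    g t - g 0 ∈ imul (timeInterval δ hδ) J := by
  have hc : ContinuousOn g (Set.Icc 0 δ) := fun s hs => (hg s hs).continuousWithinAt
  have hr := hasDerivWithinAt_Ici_of_Icc hg
  have hlin : ∀ (C s : ℝ), HasDerivAt (fun s => g 0 + C * s) C s := fun C s => by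
    simpa using ((hasDerivAt_id s).const_mul C).const_add (g 0)
  have hup := image_le_of_deriv_right_le_deriv_boundary hc hr (B := fun s => g 0 + J.snd * s)
    (by simp) (by fun_prop) (fun s _ => (hlin J.snd s).hasDerivWithinAt)
    (fun s hs => (hJ s (Set.Ico_subset_Icc_self hs)).2) ht
  have hlo := image_le_of_deriv_right_le_deriv_boundary (f := fun s => g 0 + J.fst * s)
    (by fun_prop) (fun s _ => (hlin J.fst s).hasDerivWithinAt) (by simp) hc hr
    (fun s hs => (hJ s (Set.Ico_subset_Icc_self hs)).1) ht
  have ht' : t ∈ timeInterval δ hδ := ht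
  -- For `t > 0` the element of `J` is the mean slope; at `t = 0` any element serves.
  rcases ht.1.eq_or_lt with h₀ | h₀
  · have := mul_mem_imul ht' (show J.fst ∈ J from ⟨le_rfl, J.fst_le_snd⟩)
    rw [← h₀] at this ⊢
    simpa using this
  · have : (g t - g 0) / t ∈ J :=
      ⟨(le_div_iff₀ h₀).2 (by linarith), (div_le_iff₀ h₀).2 (by linarith)⟩
    have := mul_mem_imul ht' this
    rwa [mul_div_cancel₀ _ h₀.ne'] at this

/-- The point of the box `φ + R` nearest to `w`. -/
def clampToBox {τ : Type} (R : Box τ) (φ w : τ → ℝ) : τ → ℝ :=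
  fun l => max (φ l + (R l).fst) (min (φ l + (R l).snd) (w l))

theorem clampToBox_sub_mem {τ : Type} (R : Box τ) (φ w : τ → ℝ) (l : τ) :
    clampToBox R φ w l - φ l ∈ R l := by
  have h := (R l).fst_le_snd
  constructor
  · have := le_max_left (φ l + (R l).fst) (min (φ l + (R l).snd) (w l))
    simp only [clampToBox]
    linarith
  · have : clampToBox R φ w l ≤ φ l + (R l).snd := max_le (by linarith) (min_le_left _ _)
    linarith

theorem clampToBox_eq_self {τ : Type} {R : Box τ} {φ w : τ → ℝ} (h : ∀ l, w l - φ l ∈ R l) :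
    clampToBox R φ w = w := by
  funext l
  obtain ⟨h₁, h₂⟩ := h l
  rw [clampToBox, min_eq_right (by linarith), max_eq_right (by linarith)]

theorem lipschitzWith_clampToBox {τ : Type} [Fintype τ] (R : Box τ) (φ : τ → ℝ) :
    LipschitzWith 1 (clampToBox R φ) :=
  lipschitzWith_one_pi fun l => ((LipschitzWith.eval l).const_min _).const_max _

/-- The solution `w` of the truncated equation `w' = F (clampToBox R (φ t) w)` always has its
derivative in the range of `q`, since the clamped point lies in the tube. Integration puts `w` in
the Picard image, hence in the tube, so clamping does nothing and `w` solves the original equation.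
No fixed-point argument on the tube is needed. -/
theorem PicardValidated.exists_solution {τ : Type} [Fintype τ] {F : (τ → ℝ) → (τ → ℝ)}
    (hF : LocallyLipschitz F) {Y : Box τ} {δ : ℝ} {hδ : 0 ≤ δ}
    {Φ : τ → MvPolynomial (Option τ) ℝ} {R : Box τ} (h : PicardValidated F Y δ hδ Φ R)
    {y : τ → ℝ} (hy : y ∈ Y.toSet) :
    ∃ w : ℝ → τ → ℝ, w 0 = y ∧
      (∀ t ∈ Set.Icc 0 δ, HasDerivWithinAt w (F (w t)) (Set.Icc 0 δ) t) ∧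
      ∀ t ∈ Set.Icc 0 δ, ∀ l, w t l - MvPolynomial.eval (withTime y t) (Φ l) ∈ R l := by
  obtain ⟨q, hq, hcont⟩ := h
  set φ : ℝ → τ → ℝ := fun t l => MvPolynomial.eval (withTime y t) (Φ l) with hφ
  have hφc : Continuous φ := continuous_pi fun l => continuous_eval_withTime (Φ l) y
  -- One compact set containing the tube at all times, so that `F` has a Lipschitz constant and a
  -- bound uniform in `t`.
  set C : Set (τ → ℝ) := (fun sr : ℝ × (τ → ℝ) => φ sr.1 + sr.2) ''
    (Set.Icc 0 δ ×ˢ Set.univ.pi fun l => Set.Icc (R l).fst (R l).snd) with hC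
  have hCc : IsCompact C := (isCompact_Icc.prod (isCompact_univ_pi fun _ => isCompact_Icc)).image
    ((hφc.comp continuous_fst).add continuous_snd)
  have hclamp : ∀ t ∈ Set.Icc 0 δ, ∀ w, clampToBox R (φ t) w ∈ C := fun t ht w =>
    ⟨(t, clampToBox R (φ t) w - φ t), ⟨ht, fun l _ => clampToBox_sub_mem R (φ t) w l⟩,
      add_sub_cancel _ _⟩
  obtain ⟨K, hK⟩ := hF.locallyLipschitzOn.exists_lipschitzOnWith_of_compact hCc
  obtain ⟨M, hM⟩ := hCc.exists_bound_of_continuousOn hF.continuous.continuousOn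
  -- The truncated field is bounded by `M` for every `w`, so the ball radius can be taken as `M δ`
  -- and the whole interval `[0, δ]` is covered.
  have hPL : IsPicardLindelof (fun t w => F (clampToBox R (φ t) w))
      (⟨0, le_rfl, hδ⟩ : Set.Icc 0 δ) y (M.toNNReal * δ.toNNReal) 0 M.toNNReal K :=
    { lipschitzOnWith := fun t ht => by
        have := (hK.comp (lipschitzWith_clampToBox R (φ t)).lipschitzOnWith
          (fun w _ => hclamp t ht w)).mono (Set.subset_univ (Metric.closedBall y
            (M.toNNReal * δ.toNNReal : NNReal)))
        rwa [mul_one] at this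
      continuousOn := fun w _ => by
        refine (hF.continuous.comp (continuous_pi fun l => ?_)).continuousOn
        have := continuous_pi_iff.1 hφc l
        unfold clampToBox
        fun_prop
      norm_le := fun t ht w _ => (hM _ (hclamp t ht w)).trans (Real.le_coe_toNNReal M)
      mul_max_le := by
        simp [hδ] }
  obtain ⟨w, hw₀, hw⟩ := hPL.exists_eq_forall_mem_Icc_hasDerivWithinAt₀
  have hw₀' : w 0 = y := hw₀
  have hmem : ∀ t ∈ Set.Icc 0 δ, ∀ l, w t l - φ t l ∈ R l := by
    intro t ht l
    obtain ⟨E, hE, hER⟩ := hcont l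
    -- Subtracting the integrated polynomial part leaves a derivative in the remainder of `q`.
    have hd : ∀ s ∈ Set.Icc 0 δ, HasDerivWithinAt
        (fun s => w s l - MvPolynomial.eval (withTime y s) (integTime (q l).poly))
        (F (clampToBox R (φ s) (w s)) l - MvPolynomial.eval (withTime y s) (q l).poly)
        (Set.Icc 0 δ) s := fun s hs =>
      (hasDerivWithinAt_pi.1 (hw s hs) l).sub
        (hasDerivAt_eval_integTime (q l).poly y s).hasDerivWithinAt
    have hJ : ∀ s ∈ Set.Icc 0 δ, F (clampToBox R (φ s) (w s)) l -
        MvPolynomial.eval (withTime y s) (q l).poly ∈ (q l).rem := fun s hs =>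
      mem_valueAt.1 (hq y hy s hs _ (fun l' =>
        mem_valueAt.2 (clampToBox_sub_mem R (φ s) (w s) l')) l)
    have h₁ := sub_mem_imul_of_hasDerivWithinAt hδ hd hJ ht
    have hyt : withTime y t ∈ (Y.withTime δ hδ).toSet := by
      rintro (_ | i)
      · exact ht
      · exact hy i
    have h₂ := mem_of_le hER (add_mem_add (hE _ hyt) h₁)
    simp only [eval_withTime_zero_integTime, hw₀', picardImage, map_sub, map_add,
      MvPolynomial.eval_X] at h₂
    convert h₂ using 1
    simp only [hφ, withTime, Option.elim]
    ring
  refine ⟨w, hw₀', fun t ht => ?_, hmem⟩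
  have := hw t ht
  rwa [clampToBox_eq_self (hmem t ht)] at this

theorem FlowpipeStep.exists_solution {σ τ : Type} [Fintype τ] {F : (τ → ℝ) → (τ → ℝ)}
    (hF : LocallyLipschitz F) {k : ℕ} {D : Box σ} {δ : ℝ} {hδ : 0 ≤ δ} {X : τ → TaylorModel σ}
    {P : τ → TaylorModel (Option σ)} (h : FlowpipeStep F k D δ hδ X P) {z : σ → ℝ}
    (hz : z ∈ D.toSet) {y : τ → ℝ} (hy : y ∈ boxAt X z) :
    ∃ w : ℝ → τ → ℝ, w 0 = y ∧
      (∀ t ∈ Set.Icc 0 δ, HasDerivWithinAt w (F (w t)) (Set.Icc 0 δ) t) ∧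
      ∀ t ∈ Set.Icc 0 δ, w t ∈ boxAt P (withTime z t) := by
  obtain ⟨Y, Φ, R, T, hY, hΦ, hT, hP⟩ := h
  obtain ⟨w, hw₀, hw, hwR⟩ := hΦ.exists_solution hF (fun l => hY l z hz _ (hy l))
  refine ⟨w, hw₀, hw, fun t ht l => ?_⟩
  have hzt : withTime z t ∈ (D.withTime δ hδ).toSet := by
    rintro (_ | i)
    · exact ht
    · exact hz i
  have h₁ := (hT l).eval_mem_valueAt hzt (y := withTime y t) (by
    rintro (_ | i)
    · simpa [withTime] using eval_mem_valueAt_ofPoly (MvPolynomial.X none) (withTime z t)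
    · exact mem_valueAt_liftTime (hy i))
  rw [hP l]
  have := add_mem_valueAt_addRem h₁ (hwR t ht l)
  rwa [add_sub_cancel] at this

/-! ### Executions -/

/-- Both trajectories trace compact sets, and on their union the locally Lipschitz `F` is Lipschitz,
so the standard uniqueness theorem applies. -/
theorem eqOn_of_hasDerivWithinAt {E : Type*} [NormedAddCommGroup E] [NormedSpace ℝ E] {F : E → E}
    (hF : LocallyLipschitz F) {a b : ℝ} {x y : ℝ → E}
    (hx : ∀ t ∈ Set.Icc a b, HasDerivWithinAt x (F (x t)) (Set.Icc a b) t)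
    (hy : ∀ t ∈ Set.Icc a b, HasDerivWithinAt y (F (y t)) (Set.Icc a b) t) (hxy : x a = y a) :
    Set.EqOn x y (Set.Icc a b) := by
  have hxc : ContinuousOn x (Set.Icc a b) := fun t ht => (hx t ht).continuousWithinAt
  have hyc : ContinuousOn y (Set.Icc a b) := fun t ht => (hy t ht).continuousWithinAt
  obtain ⟨K, hK⟩ := hF.locallyLipschitzOn.exists_lipschitzOnWith_of_compact
    ((isCompact_Icc.image_of_continuousOn hxc).union (isCompact_Icc.image_of_continuousOn hyc))
  exact ODE_solution_unique_of_mem_Icc_right (v := fun _ => F) (fun _ _ => hK) hxc (hasDerivWithinAt_Ici_of_Icc hx)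
    (fun t ht => Or.inl ⟨t, Set.Ico_subset_Icc_self ht, rfl⟩) hyc
    (hasDerivWithinAt_Ici_of_Icc hy)
    (fun t ht => Or.inr ⟨t, Set.Ico_subset_Icc_self ht, rfl⟩) hxy

variable {n m : ℕ} {S : NNCS n m} {x₀ : Fin n → ℝ} {T : ℝ} {x y : ℝ → Fin n → ℝ}

theorem NNCS.locallyLipschitz_f_left (S : NNCS n m) (u : Fin m → ℝ) :
    LocallyLipschitz fun v => S.f v u :=
  S.f_lip.comp (LipschitzWith.prodMk_right u).locallyLipschitz

theorem NNCS.locallyLipschitz_extField (S : NNCS n m) : LocallyLipschitz S.extField := by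
  have h₁ : LipschitzWith 1 fun y : Fin n ⊕ Fin m → ℝ =>
      ((fun i => y (Sum.inl i), fun i => y (Sum.inr i)) : (Fin n → ℝ) × (Fin m → ℝ)) := by
    have := (lipschitzWith_one_pi fun i : Fin n =>
      LipschitzWith.eval (α := fun _ : Fin n ⊕ Fin m => ℝ) (Sum.inl i)).prodMk
      (lipschitzWith_one_pi fun i : Fin m =>
        LipschitzWith.eval (α := fun _ : Fin n ⊕ Fin m => ℝ) (Sum.inr i))
    rwa [max_self] at this
  have h₂ : LipschitzWith 1 fun v : Fin n → ℝ =>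
      (Sum.elim v (fun _ => 0) : Fin n ⊕ Fin m → ℝ) := by
    refine lipschitzWith_one_pi ?_
    rintro (i | i)
    · exact LipschitzWith.eval i
    · exact LipschitzWith.const' 0
  exact h₂.locallyLipschitz.comp (S.f_lip.comp h₁.locallyLipschitz)

theorem NNCS.IsExecution.mono {T' : ℝ} (hx : S.IsExecution x₀ T x) (h : T' ≤ T) :
    S.IsExecution x₀ T' x := by
  refine ⟨hx.1, fun k t ht => ?_⟩
  have hsub := Set.Icc_subset_Icc_right (b := (k : ℝ) * S.δc)
    (min_le_min_left (((k : ℝ) + 1) * S.δc) h)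
  exact (hx.2 k t (hsub ht)).mono hsub

/-- Agreement at `k δ_c` makes the held control inputs equal, so on the next control interval both
executions solve the same ODE from the same state. -/
theorem NNCS.IsExecution.eqOn (hx : S.IsExecution x₀ T x) (hy : S.IsExecution x₀ T y) :
    Set.EqOn x y (Set.Icc 0 T) := by
  have key : ∀ k : ℕ, Set.EqOn x y (Set.Icc 0 (min ((k : ℝ) * S.δc) T)) := by
    intro k
    induction k with
    | zero =>
      rintro t ⟨h₀, h₁⟩
      have h₂ := h₁.trans (min_le_left _ _)
      rw [Nat.cast_zero, zero_mul] at h₂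
      rw [le_antisymm h₂ h₀, hx.1, hy.1]
    | succ k ih =>
      rintro t ⟨h₀, h₁⟩
      rw [le_min_iff] at h₁
      rcases le_total t (k * S.δc) with hk | hk
      · exact ih ⟨h₀, le_min hk h₁.2⟩
      have hstart : x (k * S.δc) = y (k * S.δc) :=
        ih ⟨mul_nonneg k.cast_nonneg S.δc_pos.le, le_min le_rfl (hk.trans h₁.2)⟩
      have hy' := hy.2 k
      rw [← hstart] at hy'
      push_cast at h₁
      exact eqOn_of_hasDerivWithinAt (S.locallyLipschitz_f_left _) (hx.2 k) hy' hstart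
        ⟨hk, le_min h₁.1 h₁.2⟩
  rintro t ⟨h₀, h₁⟩
  obtain ⟨k, hk⟩ := exists_nat_ge (t / S.δc)
  exact key k ⟨h₀, le_min ((div_le_iff₀ S.δc_pos).1 hk) h₁⟩

theorem NNCS.IsExecution.eq_flowmap (hx : S.IsExecution x₀ T x) (hT : 0 ≤ T) :
    x T = S.flowmap x₀ T := by
  have h : ∃ x, S.IsExecution x₀ T x := ⟨x, hx⟩
  rw [NNCS.flowmap, dif_pos h]
  exact hx.eqOn h.choose_spec ⟨hT, le_rfl⟩

/-- For `T = 0` every control interval is cut down to at most one point, where the derivative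
condition is vacuous. -/
theorem NNCS.isExecution_const (S : NNCS n m) (x₀ : Fin n → ℝ) :
    S.IsExecution x₀ 0 fun _ => x₀ := by
  refine ⟨rfl, fun k t _ => HasFDerivWithinAt.of_subsingleton ?_⟩
  rintro a ⟨ha, ha'⟩ b ⟨hb, hb'⟩
  have : 0 ≤ (k : ℝ) * S.δc := mul_nonneg k.cast_nonneg S.δc_pos.le
  rw [le_min_iff] at ha' hb'
  linarith [ha'.2, hb'.2]

/-- An execution can be prolonged by a solution within a control interval. -/
theorem NNCS.IsExecution.exists_extension (hx : S.IsExecution x₀ T x) {k : ℕ}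
    (hk : k * S.δc ≤ T) {δ : ℝ} (hδ : 0 ≤ δ) (hT : T + δ ≤ (k + 1) * S.δc) {w : ℝ → Fin n → ℝ}
    (hw₀ : w 0 = x T)
    (hw : ∀ t ∈ Set.Icc 0 δ,
      HasDerivWithinAt w (S.f (w t) (S.net.eval (x (k * S.δc)))) (Set.Icc 0 δ) t) :
    ∃ x', S.IsExecution x₀ (T + δ) x' ∧ (∀ s ≤ T, x' s = x s) ∧
      ∀ s ∈ Set.Icc 0 δ, x' (T + s) = w s := by
  have hδc := S.δc_pos
  set x' : ℝ → Fin n → ℝ := fun s => if s ≤ T then x s else w (s - T) with hx'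
  have hle : ∀ s ≤ T, x' s = x s := fun s hs => if_pos hs
  have hge : ∀ s, T ≤ s → x' s = w (s - T) := fun s hs => by
    rcases hs.eq_or_lt with rfl | hs
    · rw [hle _ le_rfl, sub_self, hw₀]
    · exact if_neg hs.not_ge
  have hT₀ : 0 ≤ T := (mul_nonneg k.cast_nonneg hδc.le).trans hk
  refine ⟨x', ⟨by rw [hle 0 hT₀, hx.1], fun k' t ht => ?_⟩, hle, fun s hs => ?_⟩
  · rcases lt_trichotomy k' k with hkk | rfl | hkk
    · have hkk' : (k' : ℝ) + 1 ≤ k := by exact_mod_cast hkk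
      have h₁ : ((k' : ℝ) + 1) * S.δc ≤ T := (mul_le_mul_of_nonneg_right hkk' hδc.le).trans hk
      rw [min_eq_left (by linarith)] at ht ⊢
      have h₂ := hx.2 k' t
      rw [min_eq_left h₁] at h₂
      rw [hle t (ht.2.trans h₁), hle (k' * S.δc) (by linarith)]
      exact (h₂ ht).congr (fun s hs => hle s (hs.2.trans h₁)) (hle t (ht.2.trans h₁))
    · rw [min_eq_right hT] at ht ⊢
      -- The current control interval is split at the gluing time `T`. A derivative within the union
      -- follows from derivatives within both pieces, and a piece whose closure misses `t` imposes
      -- nothing.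
      rw [hle _ hk, ← Set.Icc_union_Icc_eq_Icc hk (by linarith)]
      apply HasDerivWithinAt.union
      · rcases le_or_gt t T with htT | htT
        · have h₂ := hx.2 k' t
          rw [min_eq_right (by linarith)] at h₂
          rw [hle t htT]
          exact (h₂ ⟨ht.1, htT⟩).congr (fun s hs => hle s hs.2) (hle t htT)
        · refine HasFDerivWithinAt.of_notMem_closure ?_
          rw [isClosed_Icc.closure_eq]
          exact fun h => htT.not_ge h.2
      · rcases le_or_gt T t with htT | htT
        · have h₂ := hw (t - T) ⟨by linarith, by linarith [ht.2]⟩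
          rw [hge t htT]
          refine HasDerivWithinAt.congr (f := fun s => w (s - T)) ?_ (fun s hs => hge s hs.1)
            (hge t htT)
          have h₃ := HasDerivWithinAt.scomp (h := fun s => s - T) (s := Set.Icc T (T + δ)) t h₂
            ((hasDerivWithinAt_id t _).sub_const T)
            (fun s hs => ⟨by linarith [hs.1], by linarith [hs.2]⟩)
          rwa [one_smul] at h₃
        · refine HasFDerivWithinAt.of_notMem_closure ?_
          rw [isClosed_Icc.closure_eq]
          exact fun h => htT.not_ge h.1
    -- Later control intervals start no earlier than `T + δ`, so at most one point of them remains.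
    · have hkk' : (k : ℝ) + 1 ≤ k' := by exact_mod_cast hkk
      have h₁ := mul_le_mul_of_nonneg_right hkk' hδc.le
      refine HasFDerivWithinAt.of_subsingleton ?_
      rintro a ⟨ha, ha'⟩ b ⟨hb, hb'⟩
      rw [le_min_iff] at ha' hb'
      linarith [ha'.2, hb'.2]
  · rw [hge _ (by linarith [hs.1]), add_sub_cancel_left]

/-- The solution of the extended system has constant control inputs, and its state part solves the
plant equation for them. -/
theorem NNCS.hasDerivWithinAt_state {δ : ℝ} {w : ℝ → Fin n ⊕ Fin m → ℝ}
    (hw : ∀ t ∈ Set.Icc 0 δ, HasDerivWithinAt w (S.extField (w t)) (Set.Icc 0 δ) t) {t : ℝ}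
    (ht : t ∈ Set.Icc 0 δ) :
    (∀ i, w t (Sum.inr i) = w 0 (Sum.inr i)) ∧
    HasDerivWithinAt (fun s i => w s (Sum.inl i))
      (S.f (fun i => w t (Sum.inl i)) fun i => w 0 (Sum.inr i)) (Set.Icc 0 δ) t := by
  have hu : ∀ i, w t (Sum.inr i) = w 0 (Sum.inr i) := fun i => by
    have h : ∀ s ∈ Set.Icc 0 δ,
        HasDerivWithinAt (fun s => w s (Sum.inr i)) 0 (Set.Icc 0 δ) s := fun s hs =>
      hasDerivWithinAt_pi.1 (hw s hs) (Sum.inr i)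
    exact constant_of_has_deriv_right_zero (fun s hs => (h s hs).continuousWithinAt)
      (hasDerivWithinAt_Ici_of_Icc h) t ht
  refine ⟨hu, hasDerivWithinAt_pi.2 fun i => ?_⟩
  rw [← funext hu]
  exact hasDerivWithinAt_pi.1 (hw t ht) (Sum.inl i)

/-! ### Induction over the flowpipes of the closed loop -/

theorem FlowpipeStep.exists_execution {k : ℕ} {c : Settings} {D : Box (Fin n)}
    {X : Fin n ⊕ Fin m → TaylorModel (Fin n)} {P : Fin n ⊕ Fin m → TaylorModel (Option (Fin n))}
    (h : FlowpipeStep S.extField c.order D (S.stepsize c) (S.stepsize_nonneg c) X P)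
    (hD : x₀ ∈ D.toSet) (hx : S.IsExecution x₀ T x) (hk : k * S.δc ≤ T)
    (hT : T + S.stepsize c ≤ (k + 1) * S.δc)
    (hX : Sum.elim (x T) (S.net.eval (x (k * S.δc))) ∈ boxAt X x₀) :
    ∃ x', S.IsExecution x₀ (T + S.stepsize c) x' ∧ ∀ t ∈ Set.Icc 0 (S.stepsize c),
      Sum.elim (x' (T + t)) (S.net.eval (x' (k * S.δc))) ∈ boxAt P (withTime x₀ t) := by
  obtain ⟨w, hw₀, hw, hwP⟩ := h.exists_solution S.locallyLipschitz_extField hD hX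
  have hu : (fun i => w 0 (Sum.inr i)) = S.net.eval (x (k * S.δc)) := by
    rw [hw₀]
    rfl
  obtain ⟨x', hx', hxx', hwx'⟩ := hx.exists_extension hk (S.stepsize_nonneg c) hT
    (w := fun s i => w s (Sum.inl i)) (by rw [hw₀]; rfl) (fun t ht => by
      have := (NNCS.hasDerivWithinAt_state hw ht).2
      rwa [hu] at this)
  refine ⟨x', hx', fun t ht => ?_⟩
  convert hwP t ht using 1
  rw [hxx' _ hk, hwx' t ht, ← hu]
  funext i
  rcases i with i | i
  · rfl
  · exact ((NNCS.hasDerivWithinAt_state hw ht).1 i).symm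

theorem NNCS.steps_mul_stepsize (S : NNCS n m) (c : Settings) :
    c.steps * S.stepsize c = S.δc :=
  mul_div_cancel₀ _ (Nat.cast_ne_zero.2 c.steps_pos.ne')

/-- The invariant concerns the pair of the current state and the held control input, both at the
parameter `z = x₀`. The control must be included because later flowpipes of the same control step
take it from the previous Taylor model. The shifts `j = k + 1`, `i = l + 1` avoid subtraction in
`ℕ`. -/
theorem IsFlowpipe.exists_execution {c : Settings} {D : Box (Fin n)} {j i : ℕ}
    {P : Fin n ⊕ Fin m → TaylorModel (Option (Fin n))} (h : IsFlowpipe S c D j i P)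
    (hD : x₀ ∈ D.toSet) :
    ∃ k l : ℕ, j = k + 1 ∧ i = l + 1 ∧ ∃ x,
      S.IsExecution x₀ (k * S.δc + l * S.stepsize c + S.stepsize c) x ∧
      ∀ t ∈ Set.Icc 0 (S.stepsize c),
        Sum.elim (x (k * S.δc + l * S.stepsize c + t)) (S.net.eval (x (k * S.δc))) ∈
          boxAt P (withTime x₀ t) := by
  have hδ := S.stepsize_nonneg c
  have hN := S.steps_mul_stepsize c
  have hlast : S.stepsize c ∈ Set.Icc 0 (S.stepsize c) := ⟨hδ, le_rfl⟩
  have hstep : ∀ l : ℕ, l < c.steps → l * S.stepsize c + S.stepsize c ≤ S.δc := by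
    intro l hl
    have : (l : ℝ) + 1 ≤ c.steps := by exact_mod_cast hl
    nlinarith
  induction h with
  | init hU hP =>
    have h₀ : x₀ ∈ boxAt (initialTM n) x₀ := fun i => by
      simpa [initialTM] using eval_mem_valueAt_ofPoly (MvPolynomial.X i) x₀
    refine ⟨0, 0, rfl, rfl, ?_⟩
    have := hP.exists_execution (k := 0) hD (S.isExecution_const x₀) (by simp)
      (by simpa using hstep 0 c.steps_pos) (by
        rintro (i | i)
        · exact h₀ i
        · exact hU.eval_mem_boxAt hD h₀ i)
    simpa using this
  | @step j i P P' _ hi hP ih =>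
    obtain ⟨k, l, rfl, rfl, x, hx, hxP⟩ := ih
    refine ⟨k, l + 1, rfl, rfl, ?_⟩
    have hs := hstep (l + 1) hi
    push_cast at hs ⊢
    have := hP.exists_execution hD hx
      (le_add_of_le_of_nonneg (le_add_of_nonneg_right (by positivity)) hδ) (by linarith)
      (fun o => mem_valueAt_atTime (hxP _ hlast o))
    rwa [show k * S.δc + (l + 1) * S.stepsize c = k * S.δc + l * S.stepsize c + S.stepsize c by ring]
  | @control j P P' U hP hU hP' ih =>
    obtain ⟨k, l, rfl, hl, x, hx, hxP⟩ := ih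
    refine ⟨k + 1, 0, rfl, rfl, ?_⟩
    -- Here `l + 1 = N`, so the last flowpipe ends exactly at the next sampling time, where the
    -- control input is recomputed from the state part alone.
    have hT : k * S.δc + l * S.stepsize c + S.stepsize c = ((k + 1 : ℕ) : ℝ) * S.δc := by
      rw [← hN, hl]
      push_cast
      ring
    have hxP' : x (((k + 1 : ℕ) : ℝ) * S.δc) ∈
        boxAt (fun l => (statePart P l).atTime (S.stepsize c)) x₀ := fun o => by
      have := hxP _ hlast
      rw [hT] at this
      exact mem_valueAt_atTime (this (Sum.inl o))
    rw [hT] at hx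
    have := hP'.exists_execution hD hx le_rfl
      (by have := hstep 0 c.steps_pos; simp only [Nat.cast_zero] at this; linarith) (by
        rintro (o | o)
        · exact hxP' o
        · exact hU.eval_mem_boxAt hD hxP' o)
    simpa only [Nat.cast_zero, zero_mul, add_zero] using this

end NNFlow

theorem theorem1 {n m : ℕ} (S : NNFlow.NNCS n m) (c : NNFlow.Settings)
    (D : NNFlow.Box (Fin n)) (hD : S.X0 ⊆ D.toSet)
    (j i : ℕ) (P : Fin n ⊕ Fin m → TaylorModel (Option (Fin n)))
    (hP : NNFlow.IsFlowpipe S c D j i P)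
    (x₀ : Fin n → ℝ) (hx₀ : x₀ ∈ S.X0) (t : ℝ) (ht : t ∈ Set.Icc 0 (S.stepsize c))
    (τ : ℝ) (hτ : τ = ((j : ℝ) - 1) * S.δc + ((i : ℝ) - 1) * S.stepsize c + t) :
    (∃ x, S.IsExecution x₀ τ x) ∧
    (∀ x, S.IsExecution x₀ τ x → x τ = S.flowmap x₀ τ) ∧
    S.flowmap x₀ τ ∈ TaylorModel.boxAt (NNFlow.statePart P) (NNFlow.withTime x₀ t) := by
  obtain ⟨k, l, rfl, rfl, x, hx, hxP⟩ := hP.exists_execution (hD hx₀)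
  push_cast at hτ
  rw [add_sub_cancel_right, add_sub_cancel_right] at hτ
  have hδ := S.stepsize_nonneg c
  have hδc := S.δc_pos
  have hτ₀ : 0 ≤ τ := by
    have := ht.1
    rw [hτ]
    positivity
  -- The execution was built up to the end of the flowpipe and is restricted to `[0, τ]`.
  have hx' : S.IsExecution x₀ τ x := hx.mono (by linarith [ht.2])
  refine ⟨⟨x, hx'⟩, fun y hy => hy.eq_flowmap hτ₀, fun o => ?_⟩
  rw [← hx'.eq_flowmap hτ₀, hτ]
  exact hxP t ht (Sum.inl o)
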